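/- **Setting.** Logarithms of rates are to base $2$. Let $K\ge 1$ and $P_1\ge P_2\ge\cdots\ge P_K>0$. Consider the Gaussian MAC $\mathbf Y=\sum_{j=1}^K\mathbf X_j+\mathbf Z$ over $\mathbb R^n$, with $\mathbf Z\sim\mathcal N(\mathbf 0,\mathbf I)$. For a full-rank lattice $\Lambda\subset\mathbb R^n$ let $Q_\Lambda$ be a nearest-neighbour quantizer (ties broken arbitrarily, but measurably and so that $Q_\Lambda(x+\lambda)=Q_\Lambda(x)+\lambda$ for $\lambda\in\Lambda$), let $x\bmod\Lambda=x-Q_\Lambda(x)$, let $\mathcal R_\Lambda=\{x:Q_\Lambda(x)=0\}$ be the Voronoi region, and let $\sigma^2(\Lambda)=\frac1{\mathrm{Vol}(\mathcal R_\Lambda)}\cdot\frac1n\int_{\mathcal R_\Lambda}\|x\|^2dx$. A sequence of lattices $\Lambda^n\subset\mathbb R^n$ is *Rogers-good* if the ratio of the covering radius (least radius of a centred ball containing $\mathcal R_{\Lambda^n}$) to the effective radius (radius of a ball of volume $\mathrm{Vol}(\mathcal R_{\Lambda^n})$) tends to $1$. It is *Poltyrev-good* if, at every volume-to-noise ratio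 $\mu=\mathrm{Vol}(\mathcal R_{\Lambda^n})^{2/n}/(2\pi e\bar\sigma^2)>1$, $\Pr\{\mathcal N(\mathbf 0,\bar\sigma^2\mathbf I)\notin\mathcal R_{\Lambda^n}\}\le e^{-n(E_P(\mu)-o_n(1))}$, where $E_P$ is the Poltyrev exponent: $E_P(\mu)=0$ for $\mu\le1$, $\frac12(\mu-1-\ln\mu)$ for $1\le\mu\le2$, $\frac12\ln\frac{e\mu}4$ for $2\le\mu\le4$, and $\frac\mu8$ for $\mu\ge4$. Let $\Lambda_1^n\subseteq\cdots\subseteq\Lambda_K^n\subseteq\Lambda_C^n$ be lattices in $\mathbb R^n$, $n=1,2,\dots$, such that each sequence $\Lambda_i^n$ is Rogers-good and Poltyrev-good, $\Lambda_C^n$ is Poltyrev-good, and for every $\delta>0$, $P_i-\delta\le\sigma^2(\Lambda_i^n)\le P_i$ for all $i$ and all large $n$. Write $Q_i,\mathcal R_i$ and $Q_C,\mathcal R_C$ for the quantizers and Voronoi regions of $\Lambda_i^n$ and $\Lambda_C^n$. Let $\mathcal C_i=\{\lambda\bmod\Lambda_i^n:\lambda\in\Lambda_C^n\}$ and $R_i=\frac1n\log|\mathcal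 C_i|$. Let $\mathbf W_i$ (uniform on $\mathcal C_i$), $\mathbf U_i$ (uniform on $\mathcal R_i$), $1\le i\le K$, and $\mathbf Z$ be independent. Node $i$ sends $\mathbf X_i=(\mathbf W_i+\mathbf U_i)\bmod\Lambda_i^n$. With $\alpha=\sum_jP_j/(\sum_jP_j+1)$ the receiver forms $\tilde{\mathbf Y}=(\alpha\mathbf Y-\sum_j\mathbf U_j)\bmod\Lambda_1^n$ and decodes $\mathbf T=\big[\sum_j(\mathbf W_j-Q_j(\mathbf W_j+\mathbf U_j))\big]\bmod\Lambda_1^n$ as $\hat{\mathbf T}=Q_C(\tilde{\mathbf Y})\bmod\Lambda_1^n$. Let $p_e=\Pr\{\hat{\mathbf T}\ne\mathbf T\}$, $\tilde{\mathbf Z}=-(1-\alpha)\sum_j\mathbf X_j+\alpha\mathbf Z$, and $$R_i^*=\Big[\tfrac12\log\Big(\frac{P_i}{\sum_{j=1}^KP_j}+P_i\Big)\Big]^+ .$$ **Theorem.** Suppose that $\bar R_1<R_1^*$ and $R_1=\bar R_1+o_n(1)$. Then $p_e=\Pr\{\tilde{\mathbf Z}\bmod\Lambda_1^n\notin\mathcal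 R_C\}$ and $$p_e\le e^{-n\left(E_P\left(2^{2(R_1^*-\bar R_1)}\right)-o_n(1)\right)} .$$ Consequently $\mathbf T$ is computed reliably, with every coding rate as close to its target as the first: $p_e\to0$ and, for every $1\le i\le K$, $R_i\to R_i^*-(R_1^*-\bar R_1)$ as $n\to\infty$. -/

import Mathlib

open MeasureTheory ProbabilityTheory Filter
open scoped Topology

namespace NestedLattice

noncomputable section

/-- `n`-dimensional Euclidean space. -/
abbrev Vec (n : ℕ) : Type := EuclideanSpace ℝ (Fin n)

/-- A (full-rank) lattice in `ℝⁿ` together with a nearest-neighbour quantizer `Q` for it.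
Ties are broken by `Q` in an arbitrary way that is measurable and consistent with translations by
lattice points, so that `{x | Q x = 0}` is a fundamental region of the lattice. -/
structure Lattice (n : ℕ) where
  /-- the set of lattice points -/
  pts : Submodule ℤ (Vec n)
  discrete : DiscreteTopology pts
  fullRank : IsZLattice ℝ pts
  /-- the nearest-neighbour quantizer -/
  Q : Vec n → Vec n
  Q_mem : ∀ x, Q x ∈ pts
  Q_nearest : ∀ x, ∀ p ∈ pts, ‖x - Q x‖ ≤ ‖x - p‖
  Q_add : ∀ x, ∀ p ∈ pts, Q (x + p) = Q x + p
  Q_measurable : Measurable Q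

namespace Lattice

variable {n : ℕ} (L : Lattice n)

/-- `x mod Λ = x - Q x`. -/
def mod (x : Vec n) : Vec n := x - L.Q x

/-- The fundamental Voronoi region `{x | Q x = 0}`. -/
def voronoi : Set (Vec n) := {x | L.Q x = 0}

/-- Volume of the Voronoi region. -/
def vol : ℝ := (volume : Measure (Vec n)).real L.voronoi

/-- Covering radius: the least radius of a ball about the origin containing the Voronoi region. -/
def coveringRadius : ℝ := sInf {r : ℝ | 0 ≤ r ∧ L.voronoi ⊆ Metric.closedBall 0 r}

/-- Effective radius: the radius of a ball with the volume of the Voronoi region. -/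
def effectiveRadius : ℝ :=
  (L.vol / (volume : Measure (Vec n)).real (Metric.closedBall 0 1)) ^ (1 / (n : ℝ))

/-- Second moment per dimension of the Voronoi region. -/
def secondMoment : ℝ :=
  1 / L.vol * (1 / (n : ℝ)) * ∫ x in L.voronoi, ‖x‖ ^ 2

/-- Volume-to-noise ratio for Gaussian noise of variance `v` per dimension. -/
def vnr (v : ℝ) : ℝ := L.vol ^ (2 / (n : ℝ)) / (2 * Real.pi * Real.exp 1 * v)

end Lattice

/-- The Poltyrev exponent, as a function of the volume-to-noise ratio. -/
def poltyrevExponent (x : ℝ) : ℝ :=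
  if x ≤ 1 then 0
  else if x ≤ 2 then (x - 1 - Real.log x) / 2
  else if x ≤ 4 then Real.log (Real.exp 1 * x / 4) / 2
  else x / 8

/-- Rogers-goodness of a sequence of lattices of growing dimension. -/
def RogersGood (L : ∀ n, Lattice n) : Prop :=
  Tendsto (fun n => (L n).coveringRadius / (L n).effectiveRadius) atTop (𝓝 1)

/-- Poltyrev-goodness of a sequence of lattices of growing dimension: at every volume-to-noise
ratio `x`, i.i.d. Gaussian noise of standard deviation `s` leaves the Voronoi region with
probability at most `exp (-n (E_P(x) - o(1)))`. (A bound without the `o(1)` term implies this.) -/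
def PoltyrevGood (L : ∀ n, Lattice n) : Prop :=
  ∀ x : ℝ, 1 < x → ∀ ε : ℝ, 0 < ε → ∀ᶠ n : ℕ in atTop, ∀ s : ℝ, 0 < s → (L n).vnr (s ^ 2) = x →
    (stdGaussian (Vec n)).real {z | s • z ∉ (L n).voronoi} ≤
      Real.exp (-(n : ℝ) * (poltyrevExponent x - ε))

/-- An `n`-dimensional chain `Λ₁ ⊆ ⋯ ⊆ Λ_K ⊆ Λ_C` of lattices. The index `0 : Fin K` stands
for node `1`. -/
structure LatticeChain (K n : ℕ) where
  shaping : Fin K → Lattice n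
  coding : Lattice n
  shaping_mono : ∀ i j, i ≤ j → (shaping i).pts ≤ (shaping j).pts
  shaping_le_coding : ∀ i, (shaping i).pts ≤ coding.pts

/-- The MMSE scaling coefficient for power constraints `P`. -/
def mmse {K : ℕ} (P : Fin K → ℝ) : ℝ := (∑ j, P j) / ((∑ j, P j) + 1)

/-- `R_i^* = [½ log₂ (P_i / ∑ P_j + P_i)]⁺`. -/
def targetRate {K : ℕ} (P : Fin K → ℝ) (i : Fin K) : ℝ :=
  max (1 / 2 * Real.logb 2 (P i / (∑ j, P j) + P i)) 0

namespace LatticeChain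

variable {K n : ℕ} (c : LatticeChain K n)

/-- The code of node `i`: the coset leaders `Λ_C mod Λ_i`. -/
def code (i : Fin K) : Set (Vec n) := (c.shaping i).mod '' (c.coding.pts : Set (Vec n))

/-- The coding rate `(1/n) log₂ |C_i|` of node `i`. -/
def rate (i : Fin K) : ℝ := 1 / (n : ℝ) * Real.logb 2 ((c.code i).ncard : ℝ)

/-- An outcome `(W, U, Z)`: codewords, dithers and channel noise. -/
abbrev Outcome (K n : ℕ) : Type := (Fin K → Vec n) × (Fin K → Vec n) × Vec n

/-- The joint law of `(W, U, Z)`: all independent, `W_i` uniform over the code of node `i`,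
`U_i` uniform over the Voronoi region of `Λ_i`, and `Z` i.i.d. standard Gaussian. -/
def law : Measure (Outcome K n) :=
  (Measure.pi fun i => uniformOn (c.code i)).prod
    ((Measure.pi fun i => cond volume (c.shaping i).voronoi).prod (stdGaussian (Vec n)))

/-- Channel input of node `i`: `X_i = (W_i + U_i) mod Λ_i`. -/
def input (i : Fin K) (ω : Outcome K n) : Vec n := (c.shaping i).mod (ω.1 i + ω.2.1 i)

/-- Channel output: `Y = ∑ X_j + Z`. -/
def output (ω : Outcome K n) : Vec n := (∑ j, c.input j ω) + ω.2.2

/-- Effective noise: `Z̃ = -(1 - a) ∑ X_j + a Z`, with scaling factor `a`. -/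
def effNoise (a : ℝ) (ω : Outcome K n) : Vec n := -((1 - a) • ∑ j, c.input j ω) + a • ω.2.2

variable [NeZero K]

/-- The modular sum `T = [∑ (W_j - Q_j (W_j + U_j))] mod Λ₁`. -/
def modSum (ω : Outcome K n) : Vec n :=
  (c.shaping 0).mod (∑ j, (ω.1 j - (c.shaping j).Q (ω.1 j + ω.2.1 j)))

/-- The processed channel output `Ỹ = (a Y - ∑ U_j) mod Λ₁`. -/
def processed (a : ℝ) (ω : Outcome K n) : Vec n :=
  (c.shaping 0).mod (a • c.output ω - ∑ j, ω.2.1 j)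

/-- Euclidean lattice decoding of `T`: the point of `Λ_C` closest to `Ỹ`, reduced modulo `Λ₁`. -/
def decoded (a : ℝ) (ω : Outcome K n) : Vec n :=
  (c.shaping 0).mod (c.coding.Q (c.processed a ω))

/-- The probability that the decoder does not return `T`. -/
def errorProb (a : ℝ) : ℝ := c.law.real {ω | c.modSum ω ≠ c.decoded a ω}

end LatticeChain

/-- A sequence of lattice chains adapted to the power constraints `P`: the `Λ_i` are Rogers-good
and Poltyrev-good, `Λ_C` is Poltyrev-good, and the second moment of `Λ_i` is at most `P_i` for
large `n` and tends to `P_i`. -/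
structure GoodChain {K : ℕ} (P : Fin K → ℝ) (c : ∀ n, LatticeChain K n) : Prop where
  shaping_rogers : ∀ i, RogersGood fun n => (c n).shaping i
  shaping_poltyrev : ∀ i, PoltyrevGood fun n => (c n).shaping i
  coding_poltyrev : PoltyrevGood fun n => (c n).coding
  power : ∀ i, ∀ δ : ℝ, 0 < δ → ∀ᶠ n in atTop,
    P i - δ ≤ ((c n).shaping i).secondMoment ∧ ((c n).shaping i).secondMoment ≤ P i

end

end NestedLattice

/-! Subtracting the dithers leaves `αY - ∑ U_j = Z̃ + t` with `t ∈ Λ_C` and `T = t mod Λ₁`.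
Nearest-point decoding commutes with translation by `t`, so it fails exactly when `Q_C(Z̃) ∉ Λ₁`.
Ties are null events, so almost surely this means `Z̃ mod Λ₁ ∉ R_C`. It also implies `Z̃ ∉ R_C`, and
only this larger event has to be bounded.

By the crypto lemma the inputs are independent and uniform on their Voronoi regions. Rogers-goodness
makes covering and effective radii asymptotic to `√(n P_j)`, so each uniform density is at most
`e^{o(n)}` times the density of `N(0, P_j I)`. Hence the law of `Z̃` is at most `e^{o(n)}` times a
Gaussian law of variance `(1-α)² ∑ P_j + α² = α` (`law_effNoise_le`).

Since `Vol(Λ_C) = Vol(Λ₁) 2^{-n R₁}`, `Vol(Λ₁)^{2/n}` is asymptotically at least `2πe P₁`, and `P₁/α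
= P₁/∑ P_j + P₁`, the volume-to-noise ratio of `Λ_C` is at least `2^{2(R₁* - R̄₁)}` up to
arbitrarily small slack. Poltyrev-goodness of `Λ_C`, star-shapedness of `R_C` and left-continuity of
`E_P` give the exponent.

Rate differences are logarithms of volume ratios, hence tend to `½ log(P_i/P₁)`. Rates are
nonnegative, which makes the positive parts in the targets inactive. -/

namespace NestedLattice

noncomputable section

/-! ### Lattices: quantizers, Voronoi regions, radii and second moments -/

namespace Lattice

variable {n : ℕ} (L : Lattice n)

instance : DiscreteTopology L.pts := L.discrete

instance : IsZLattice ℝ L.pts := L.fullRank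

instance : Countable L.pts := inferInstance

theorem Q_sub {p : Vec n} (hp : p ∈ L.pts) (x : Vec n) : L.Q (x - p) = L.Q x - p := by
  have h := L.Q_add (x - p) p hp
  rw [sub_add_cancel] at h
  rw [h, add_sub_cancel_right]

theorem mem_voronoi {x : Vec n} : x ∈ L.voronoi ↔ L.Q x = 0 := Iff.rfl

theorem mod_mem_voronoi (x : Vec n) : L.mod x ∈ L.voronoi := by
  rw [mem_voronoi, mod, L.Q_sub (L.Q_mem x), sub_self]

theorem mod_add {p : Vec n} (hp : p ∈ L.pts) (x : Vec n) : L.mod (x + p) = L.mod x := by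
  simp [mod, L.Q_add x p hp]

theorem mod_of_mem_voronoi {x : Vec n} (hx : x ∈ L.voronoi) : L.mod x = x := by
  rw [mem_voronoi] at hx
  simp [mod, hx]

theorem mod_eq_mod_iff {x y : Vec n} : L.mod x = L.mod y ↔ x - y ∈ L.pts := by
  constructor
  · intro h
    have h2 : x - y = L.Q x - L.Q y := by
      simp only [mod] at h
      rw [sub_eq_sub_iff_sub_eq_sub] at h
      exact h
    rw [h2]
    exact sub_mem (L.Q_mem x) (L.Q_mem y)
  · intro h
    have := L.mod_add h y
    rwa [add_sub_cancel] at this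

theorem measurable_mod : Measurable L.mod := measurable_id.sub L.Q_measurable

theorem measurableSet_voronoi : MeasurableSet L.voronoi :=
  L.Q_measurable (measurableSet_singleton 0)

/-- Translation equivariance of `Q` makes `-Q x` the unique lattice vector carrying `x` into the
region, ties included. -/
theorem isAddFundamentalDomain_voronoi :
    IsAddFundamentalDomain L.pts L.voronoi (volume : Measure (Vec n)) := by
  refine IsAddFundamentalDomain.mk' L.measurableSet_voronoi.nullMeasurableSet fun x => ?_
  refine ⟨⟨-L.Q x, neg_mem (L.Q_mem x)⟩, ?_, fun g hg => ?_⟩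
  · change -L.Q x + x ∈ L.voronoi
    rw [neg_add_eq_sub]
    exact L.mod_mem_voronoi x
  · have h : L.Q ((g : Vec n) + x) = 0 := hg
    rw [add_comm, L.Q_add x g g.2] at h
    ext1
    exact eq_neg_of_add_eq_zero_right h

theorem vol_eq_covolume : L.vol = ZLattice.covolume L.pts :=
  (ZLattice.covolume_eq_measure_fundamentalDomain L.pts volume
    L.isAddFundamentalDomain_voronoi).symm

theorem vol_pos : 0 < L.vol := L.vol_eq_covolume ▸ ZLattice.covolume_pos L.pts volume

theorem volume_voronoi_ne_zero : (volume : Measure (Vec n)) L.voronoi ≠ 0 := fun h =>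
  L.vol_pos.ne' (by simp [vol, measureReal_def, h])

theorem volume_voronoi_ne_top : (volume : Measure (Vec n)) L.voronoi ≠ ⊤ := fun h =>
  L.vol_pos.ne' (by simp [vol, measureReal_def, h])

instance isProbabilityMeasure_cond_voronoi :
    IsProbabilityMeasure (cond (volume : Measure (Vec n)) L.voronoi) :=
  cond_isProbabilityMeasure_of_finite L.volume_voronoi_ne_zero L.volume_voronoi_ne_top

/-- A dithered and reduced vector is uniform over the Voronoi region (the crypto lemma). -/
theorem map_mod_add_cond_voronoi (v : Vec n) :
    (cond (volume : Measure (Vec n)) L.voronoi).map (fun u => L.mod (v + u)) =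
      cond volume L.voronoi := by
  have hm : Measurable fun u => L.mod (v + u) := L.measurable_mod.comp (measurable_const_add v)
  ext A hA
  rw [Measure.map_apply hm hA, cond_apply L.measurableSet_voronoi,
    cond_apply L.measurableSet_voronoi]
  congr 1
  have hmod : L.voronoi ∩ A = L.mod ⁻¹' A ∩ L.voronoi := by
    ext x
    simp only [Set.mem_inter_iff, Set.mem_preimage]
    constructor
    · rintro ⟨h1, h2⟩
      exact ⟨by rwa [L.mod_of_mem_voronoi h1], h1⟩
    · rintro ⟨h1, h2⟩
      exact ⟨h2, by rwa [L.mod_of_mem_voronoi h2] at h1⟩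
  -- The region translated by `-v` is also a fundamental domain, and a periodic set has the same
  -- measure in both. On this one, reduction of `v + u` does nothing, so only a translation remains.
  have hT : IsAddFundamentalDomain L.pts ((fun u => v + u) ⁻¹' L.voronoi)
      (volume : Measure (Vec n)) := by
    refine IsAddFundamentalDomain.mk'
      ((measurable_const_add v) L.measurableSet_voronoi).nullMeasurableSet fun x => ?_
    refine ⟨⟨-L.Q (v + x), neg_mem (L.Q_mem _)⟩, ?_, fun g hg => ?_⟩
    · change v + (-L.Q (v + x) + x) ∈ L.voronoi
      have : v + (-L.Q (v + x) + x) = L.mod (v + x) := by simp only [mod]; abel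
      rw [this]
      exact L.mod_mem_voronoi _
    · have h : L.Q (v + ((g : Vec n) + x)) = 0 := hg
      rw [show v + ((g : Vec n) + x) = v + x + g by abel, L.Q_add _ g g.2] at h
      ext1
      exact eq_neg_of_add_eq_zero_right h
  have hinv : ∀ g : L.pts, (fun x => g +ᵥ x) ⁻¹' ((fun u => L.mod (v + u)) ⁻¹' A) =
      (fun u => L.mod (v + u)) ⁻¹' A := by
    intro g
    ext x
    change L.mod (v + ((g : Vec n) + x)) ∈ A ↔ L.mod (v + x) ∈ A
    rw [show v + ((g : Vec n) + x) = v + x + g by abel, L.mod_add g.2]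
  have : VAddInvariantMeasure L.pts (Vec n) (volume : Measure (Vec n)) :=
    (inferInstance : VAddInvariantMeasure L.pts.toAddSubgroup (Vec n) volume)
  have : MeasurableVAdd L.pts (Vec n) :=
    (inferInstance : MeasurableVAdd L.pts.toAddSubgroup (Vec n))
  have key := L.isAddFundamentalDomain_voronoi.measure_set_eq hT (hm hA) hinv
  rw [Set.inter_comm, key, hmod,
    ← measure_preimage_add (volume : Measure (Vec n)) v (L.mod ⁻¹' A ∩ L.voronoi)]
  rfl

/-- The coset leaders of a lattice modulo a sublattice are counted by the ratio of volumes. -/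
theorem ncard_mod_image (M : Lattice n) (h : L.pts ≤ M.pts) :
    ((L.mod '' (M.pts : Set (Vec n))).ncard : ℝ) = L.vol / M.vol := by
  rw [L.vol_eq_covolume, M.vol_eq_covolume, ZLattice.covolume_div_covolume_eq_relIndex' _ _ h]
  congr 1
  rw [AddSubgroup.relIndex, AddSubgroup.index, ← Nat.card_coe_set_eq]
  let f : M.pts.toAddSubgroup → (L.mod '' (M.pts : Set (Vec n))) :=
    fun x => ⟨L.mod x, x, x.2, rfl⟩
  have hf : Function.Surjective f := by
    rintro ⟨_, x, hx, rfl⟩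
    exact ⟨⟨x, hx⟩, rfl⟩
  -- Coset leaders correspond to elements of the quotient group, whose order is the ratio of
  -- covolumes.
  have hker : ∀ a b, f a = f b ↔
      (QuotientAddGroup.leftRel (L.pts.toAddSubgroup.addSubgroupOf M.pts.toAddSubgroup)) a b := by
    intro a b
    rw [QuotientAddGroup.leftRel_apply, AddSubgroup.mem_addSubgroupOf, Subtype.ext_iff]
    change L.mod (a : Vec n) = L.mod (b : Vec n) ↔ (-(a : Vec n) + b) ∈ L.pts
    rw [eq_comm, L.mod_eq_mod_iff, neg_add_eq_sub]
  refine Nat.card_congr (Equiv.ofBijective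
    (Quotient.lift f fun a b hab => (hker a b).2 hab) ⟨?_, ?_⟩).symm
  · rintro ⟨a⟩ ⟨b⟩ hab
    exact Quotient.sound ((hker a b).1 hab)
  · intro y
    obtain ⟨x, rfl⟩ := hf y
    exact ⟨⟦x⟧, rfl⟩

theorem norm_le_norm_sub_of_mem_voronoi {x p : Vec n} (hx : x ∈ L.voronoi) (hp : p ∈ L.pts) :
    ‖x‖ ≤ ‖x - p‖ := by
  have h := L.Q_nearest x p hp
  rw [L.mem_voronoi] at hx
  rwa [hx, sub_zero] at h

/-- The Voronoi region is star-shaped about the origin. -/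
theorem smul_mem_voronoi {x : Vec n} {s t : ℝ} (hs : 0 < s) (hst : s ≤ t)
    (hx : t • x ∈ L.voronoi) : s • x ∈ L.voronoi := by
  rcases hst.eq_or_lt with rfl | hlt
  · exact hx
  by_contra hne
  rw [mem_voronoi] at hne
  set p := L.Q (s • x) with hp
  have h1 := L.Q_nearest (s • x) 0 (zero_mem _)
  have h2 := L.norm_le_norm_sub_of_mem_voronoi hx (L.Q_mem (s • x))
  rw [← hp] at h1 h2
  rw [sub_zero] at h1
  have h1' := pow_le_pow_left₀ (norm_nonneg _) h1 2
  have h2' := pow_le_pow_left₀ (norm_nonneg _) h2 2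
  rw [norm_sub_sq_real, real_inner_smul_left] at h1' h2'
  have hp0 : 0 < ‖p‖ ^ 2 := by
    have := norm_pos_iff.2 hne
    positivity
  -- `p` is at least as close to `s • x` as `0` is, while `0` is at least as close to `t • x` as `p`
  -- is. As `s < t` strictly, these conflict however ties are broken.
  have a1 : ‖p‖ ^ 2 ≤ 2 * (s * inner ℝ x p) := by linarith
  have a2 : 2 * (t * inner ℝ x p) ≤ ‖p‖ ^ 2 := by linarith
  have hin : 0 < inner ℝ x p := by
    by_contra hcon
    nlinarith [mul_nonpos_of_nonneg_of_nonpos hs.le (not_lt.1 hcon)]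
  nlinarith

/-- Almost no point has two nearest lattice points. -/
theorem ae_unique_nearest : ∀ᵐ x ∂(volume : Measure (Vec n)), ∀ p ∈ L.pts, ∀ q ∈ L.pts,
    ‖x - p‖ = ‖x - q‖ → p = q := by
  have key : ∀ p q : L.pts, ∀ᵐ x ∂(volume : Measure (Vec n)),
      ‖x - (p : Vec n)‖ = ‖x - (q : Vec n)‖ → (p : Vec n) = q := by
    intro p q
    by_cases hpq : (p : Vec n) = q
    · exact Eventually.of_forall fun _ _ => hpq
    -- Ties between two distinct points lie on their bisecting hyperplane, and there are countably
    -- many pairs.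
    have hnull : (volume : Measure (Vec n))
        (AffineSubspace.perpBisector (p : Vec n) (q : Vec n) : Set (Vec n)) = 0 :=
      Measure.addHaar_affineSubspace _ _ (by
        rw [Ne, AffineSubspace.perpBisector_eq_top]
        exact hpq)
    filter_upwards [measure_eq_zero_iff_ae_notMem.1 hnull] with x hx heq
    refine absurd ?_ hx
    rw [SetLike.mem_coe, AffineSubspace.mem_perpBisector_iff_dist_eq, dist_eq_norm, dist_eq_norm]
    exact heq
  have := ae_all_iff.2 fun p : L.pts => ae_all_iff.2 (key p)
  filter_upwards [this] with x hx p hp q hq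
  exact hx ⟨p, hp⟩ ⟨q, hq⟩

/-- For almost all points, the nearest point of a finer lattice lies in the coarser lattice only
if it is the point selected by the quantizer of the coarser lattice. -/
theorem ae_Q_eq_of_mem (M : Lattice n) (h : L.pts ≤ M.pts) :
    ∀ᵐ x ∂(volume : Measure (Vec n)), M.Q x ∈ L.pts → M.Q x = L.Q x := by
  filter_upwards [L.ae_unique_nearest] with x hx hmem
  exact hx _ hmem _ (L.Q_mem x) (le_antisymm (M.Q_nearest x _ (h (L.Q_mem x)))
    (L.Q_nearest x _ hmem))

theorem voronoi_subset_closedBall (h : L.coveringRadius ≠ 0) :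
    L.voronoi ⊆ Metric.closedBall 0 L.coveringRadius := by
  have hne : {r : ℝ | 0 ≤ r ∧ L.voronoi ⊆ Metric.closedBall 0 r}.Nonempty := by
    by_contra hcon
    rw [Set.not_nonempty_iff_eq_empty] at hcon
    -- With no admissible radius the infimum would take its default value `0`.
    exact h (by rw [coveringRadius, hcon, Real.sInf_empty])
  intro x hx
  rw [mem_closedBall_zero_iff]
  refine le_csInf hne ?_
  rintro r ⟨-, hr⟩
  exact mem_closedBall_zero_iff.1 (hr hx)

theorem secondMoment_le {r : ℝ} (h : L.voronoi ⊆ Metric.closedBall 0 r) :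
    L.secondMoment ≤ r ^ 2 / n := by
  have hle : ∫ x in L.voronoi, ‖x‖ ^ 2 ≤ r ^ 2 * L.vol := by
    have h1 : ‖∫ x in L.voronoi, ‖x‖ ^ 2‖ ≤ r ^ 2 * L.vol := by
      refine norm_setIntegral_le_of_norm_le_const L.volume_voronoi_ne_top.lt_top fun x hx => ?_
      rw [Real.norm_of_nonneg (by positivity)]
      exact pow_le_pow_left₀ (norm_nonneg _) (mem_closedBall_zero_iff.1 (h hx)) 2
    exact (le_abs_self _).trans h1
  have hv := L.vol_pos
  calc L.secondMoment ≤ 1 / L.vol * (1 / (n : ℝ)) * (r ^ 2 * L.vol) := by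
        unfold secondMoment; gcongr
    _ = r ^ 2 / n := by field_simp

theorem volume_closedBall_one_pos : 0 < (volume : Measure (Vec n)).real (Metric.closedBall 0 1) :=
  ENNReal.toReal_pos (Metric.measure_closedBall_pos _ _ one_pos).ne'
    measure_closedBall_lt_top.ne

theorem effectiveRadius_pos : 0 < L.effectiveRadius :=
  Real.rpow_pos_of_pos (div_pos L.vol_pos volume_closedBall_one_pos) _

theorem effectiveRadius_pow (hn : n ≠ 0) : L.effectiveRadius ^ n *
    (volume : Measure (Vec n)).real (Metric.closedBall 0 1) = L.vol := by
  rw [effectiveRadius, one_div, Real.rpow_inv_natCast_pow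
    (div_pos L.vol_pos volume_closedBall_one_pos).le hn,
    div_mul_cancel₀ _ volume_closedBall_one_pos.ne']

/-- The ball of radius `b` times the effective radius has only `b ^ n` times the volume of the
region; the part of the region outside it contributes enough. The radius `r` serves only for
integrability. -/
theorem le_secondMoment {r : ℝ} (h : L.voronoi ⊆ Metric.closedBall 0 r) (hn : n ≠ 0)
    {b : ℝ} (hb : 0 < b) :
    b ^ 2 * (1 - b ^ n) * (L.effectiveRadius ^ 2 / n) ≤ L.secondMoment := by
  have hv := L.vol_pos
  have he := L.effectiveRadius_pos
  set B : Set (Vec n) := Metric.closedBall 0 (b * L.effectiveRadius) with hB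
  have hBvol : (volume : Measure (Vec n)).real B = b ^ n * L.vol := by
    rw [hB, Measure.addHaar_real_closedBall' _ _ (by positivity), finrank_euclideanSpace_fin,
      mul_pow, mul_assoc, L.effectiveRadius_pow hn]
  have hint : IntegrableOn (fun x : Vec n => ‖x‖ ^ 2) L.voronoi := by
    refine Measure.integrableOn_of_bounded (M := r ^ 2) L.volume_voronoi_ne_top
      (by fun_prop) ?_
    filter_upwards [ae_restrict_mem L.measurableSet_voronoi] with x hx
    rw [Real.norm_of_nonneg (by positivity)]
    exact pow_le_pow_left₀ (norm_nonneg _) (mem_closedBall_zero_iff.1 (h hx)) 2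
  have hvol : (1 - b ^ n) * L.vol ≤ (volume : Measure (Vec n)).real (L.voronoi \ B) := by
    have h1 := le_measureReal_sdiff (μ := (volume : Measure (Vec n))) (s₁ := L.voronoi) (s₂ := B)
      (h := measure_closedBall_lt_top.ne)
    rw [hBvol] at h1
    unfold vol at *
    linarith
  have h1 : (b * L.effectiveRadius) ^ 2 * (volume : Measure (Vec n)).real (L.voronoi \ B) ≤
      ∫ x in L.voronoi, ‖x‖ ^ 2 := by
    calc _ = ∫ x in L.voronoi \ B, (b * L.effectiveRadius) ^ 2 := by
          rw [setIntegral_const, smul_eq_mul, mul_comm]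
      _ ≤ ∫ x in L.voronoi \ B, ‖x‖ ^ 2 := by
          refine setIntegral_mono_on ?_ (hint.mono_set Set.sdiff_subset)
            (L.measurableSet_voronoi.diff Metric.isClosed_closedBall.measurableSet) ?_
          · exact integrableOn_const (measure_ne_top_of_subset Set.sdiff_subset
              L.volume_voronoi_ne_top)
          · intro x hx
            have := hx.2
            rw [hB, mem_closedBall_zero_iff, not_le] at this
            exact pow_le_pow_left₀ (by positivity) this.le 2
      _ ≤ _ := setIntegral_mono_set hint (Eventually.of_forall fun x => by positivity)
          Set.sdiff_subset.eventuallyLE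
  have hn' : (0 : ℝ) < n := by positivity
  calc b ^ 2 * (1 - b ^ n) * (L.effectiveRadius ^ 2 / n)
      = 1 / L.vol * (1 / (n : ℝ)) * ((b * L.effectiveRadius) ^ 2 * ((1 - b ^ n) * L.vol)) := by
        field_simp
    _ ≤ 1 / L.vol * (1 / (n : ℝ)) * ((b * L.effectiveRadius) ^ 2 *
          (volume : Measure (Vec n)).real (L.voronoi \ B)) := by gcongr
    _ ≤ _ := by unfold secondMoment; gcongr

end Lattice

/-! ### Gaussian densities and linear combinations -/

section Gaussian

open scoped ENNReal

/-- The density of a standard Gaussian vector. -/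
theorem pi_gaussianReal_eq_withDensity (n : ℕ) :
    Measure.pi (fun _ : Fin n => gaussianReal 0 1) =
      (volume : Measure (Fin n → ℝ)).withDensity
        (fun x => ENNReal.ofReal (∏ i, gaussianPDFReal 0 1 (x i))) := by
  refine Measure.pi_eq fun s hs => ?_
  have hint : IntegrableOn (fun x : Fin n → ℝ => ∏ i, gaussianPDFReal 0 1 (x i))
      (Set.univ.pi s) := by
    rw [IntegrableOn, volume_pi, Measure.restrict_pi_pi]
    exact Integrable.fintype_prod fun i => (integrable_gaussianPDFReal 0 1).integrableOn
  rw [withDensity_apply _ (MeasurableSet.univ_pi hs),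
    ← ofReal_integral_eq_lintegral_ofReal hint
      (Eventually.of_forall fun x => Finset.prod_nonneg fun i _ => gaussianPDFReal_nonneg 0 1 _),
    volume_pi, Measure.restrict_pi_pi,
    integral_fintype_prod_eq_prod (fun _ : Fin n => gaussianPDFReal 0 1),
    ENNReal.ofReal_prod_of_nonneg fun i _ =>
      integral_nonneg fun x => gaussianPDFReal_nonneg 0 1 x]
  exact Finset.prod_congr rfl fun i _ =>
    (gaussianReal_apply_eq_integral 0 one_ne_zero (s i)).symm

theorem prod_gaussianPDFReal {n : ℕ} (x : Vec n) :
    ∏ i, gaussianPDFReal 0 1 (x i) =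
      ((Real.sqrt (2 * Real.pi))⁻¹) ^ n * Real.exp (-‖x‖ ^ 2 / 2) := by
  simp only [gaussianPDFReal, NNReal.coe_one, mul_one, sub_zero]
  rw [Finset.prod_mul_distrib, Finset.prod_const, Finset.card_univ, Fintype.card_fin,
    ← Real.exp_sum, EuclideanSpace.real_norm_sq_eq, ← Finset.sum_div, Finset.sum_neg_distrib]

theorem stdGaussian_eq_withDensity (n : ℕ) :
    stdGaussian (Vec n) = (volume : Measure (Vec n)).withDensity
      (fun x => ENNReal.ofReal (((Real.sqrt (2 * Real.pi))⁻¹) ^ n * Real.exp (-‖x‖ ^ 2 / 2))) := by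
  rw [← map_pi_eq_stdGaussian, pi_gaussianReal_eq_withDensity]
  ext A hA
  have hm : Measurable (WithLp.toLp 2 : (Fin n → ℝ) → Vec n) := by fun_prop
  rw [Measure.map_apply hm hA, withDensity_apply _ (hm hA), withDensity_apply _ hA,
    ← (PiLp.volume_preserving_toLp (Fin n)).setLIntegral_comp_preimage hA (by fun_prop)]
  refine lintegral_congr fun x => ?_
  rw [← prod_gaussianPDFReal]

theorem stdGaussian_absolutelyContinuous (n : ℕ) :
    stdGaussian (Vec n) ≪ (volume : Measure (Vec n)) := by
  rw [stdGaussian_eq_withDensity]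
  exact withDensity_absolutelyContinuous _ _

theorem le_stdGaussian {n : ℕ} {A : Set (Vec n)} {r : ℝ} (hr : ∀ x ∈ A, ‖x‖ ≤ r)
    (hA : MeasurableSet A) :
    ENNReal.ofReal (((Real.sqrt (2 * Real.pi))⁻¹) ^ n * Real.exp (-r ^ 2 / 2)) *
      (volume : Measure (Vec n)) A ≤ stdGaussian (Vec n) A := by
  rw [stdGaussian_eq_withDensity, withDensity_apply _ hA, ← setLIntegral_const]
  refine setLIntegral_mono' hA fun x hx => ENNReal.ofReal_le_ofReal ?_
  have := pow_le_pow_left₀ (norm_nonneg _) (hr x hx) 2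
  gcongr

/-- The volume of a subset of a ball is bounded by its Gaussian measure. -/
theorem volume_le_gaussian {n : ℕ} {A : Set (Vec n)} {r s : ℝ} (hs : 0 < s)
    (hr : ∀ x ∈ A, ‖x‖ ≤ r) (hA : MeasurableSet A) :
    (volume : Measure (Vec n)) A ≤
      ENNReal.ofReal ((Real.sqrt (2 * Real.pi) * s) ^ n * Real.exp (r ^ 2 / (2 * s ^ 2))) *
        (stdGaussian (Vec n)).map (fun z => s • z) A := by
  have hm : Measurable fun z : Vec n => s • z := measurable_const_smul s
  rw [Measure.map_apply hm hA]
  have h1 := le_stdGaussian (A := (fun z : Vec n => s • z) ⁻¹' A) (r := r / s) (by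
    intro x hx
    have := hr _ hx
    rw [norm_smul, Real.norm_of_nonneg hs.le] at this
    rwa [le_div_iff₀ hs, mul_comm]) (hm hA)
  have h2 : (volume : Measure (Vec n)) ((fun z : Vec n => s • z) ⁻¹' A) =
      ENNReal.ofReal ((s ^ n)⁻¹) * (volume : Measure (Vec n)) A := by
    rw [Measure.addHaar_preimage_smul _ hs.ne', finrank_euclideanSpace_fin,
      abs_of_pos (by positivity)]
  rw [h2, ← mul_assoc, ← ENNReal.ofReal_mul (by positivity)] at h1
  refine le_trans ?_ (mul_le_mul_right h1 _)
  rw [← mul_assoc, ← ENNReal.ofReal_mul (by positivity)]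
  have h3 : (Real.sqrt (2 * Real.pi) * s) ^ n * Real.exp (r ^ 2 / (2 * s ^ 2)) *
      ((Real.sqrt (2 * Real.pi))⁻¹ ^ n * Real.exp (-(r / s) ^ 2 / 2) * (s ^ n)⁻¹) = 1 := by
    have h4 : Real.exp (-(r / s) ^ 2 / 2) = (Real.exp (r ^ 2 / (2 * s ^ 2)))⁻¹ := by
      rw [← Real.exp_neg]
      congr 1
      field_simp
    have := Real.exp_ne_zero (r ^ 2 / (2 * s ^ 2))
    rw [h4, mul_pow, inv_pow]
    field_simp
  rw [h3, ENNReal.ofReal_one, one_mul]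

/-- A linear combination of independent standard Gaussian vectors is Gaussian. -/
theorem map_linearCombination_stdGaussian {ι : Type*} [Fintype ι] {n : ℕ} (a : ι → ℝ) (b s : ℝ)
    (h : ∑ j, a j ^ 2 + b ^ 2 = s ^ 2) :
    ((Measure.pi fun _ : ι => stdGaussian (Vec n)).prod (stdGaussian (Vec n))).map
      (fun p => ∑ j, a j • p.1 j + b • p.2) = (stdGaussian (Vec n)).map (fun z => s • z) := by
  have hm : Measurable fun p : (ι → Vec n) × Vec n => ∑ j, a j • p.1 j + b • p.2 := by fun_prop
  have : IsProbabilityMeasure (((Measure.pi fun _ : ι => stdGaussian (Vec n)).prod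
      (stdGaussian (Vec n))).map (fun p => ∑ j, a j • p.1 j + b • p.2)) :=
    Measure.isProbabilityMeasure_map hm.aemeasurable
  have : IsProbabilityMeasure ((stdGaussian (Vec n)).map (fun z => s • z)) :=
    Measure.isProbabilityMeasure_map (by fun_prop)
  -- Characteristic functions factor by independence, and the variances add.
  refine Measure.ext_of_charFun (funext fun t => ?_)
  rw [charFun_map_smul, charFun_stdGaussian, charFun_apply,
    integral_map hm.aemeasurable (by fun_prop)]
  have hsplit : ∀ p : (ι → Vec n) × Vec n,
      Complex.exp ((inner ℝ (∑ j, a j • p.1 j + b • p.2) t : ℝ) * Complex.I) =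
      (∏ j, Complex.exp ((inner ℝ (p.1 j) (a j • t) : ℝ) * Complex.I)) *
        Complex.exp ((inner ℝ p.2 (b • t) : ℝ) * Complex.I) := by
    intro p
    rw [inner_add_left, sum_inner, ← Complex.exp_sum, ← Complex.exp_add, ← Finset.sum_mul,
      ← add_mul]
    congr 2
    push_cast
    simp only [real_inner_smul_left, real_inner_smul_right]
  simp_rw [hsplit]
  rw [integral_prod_mul (fun x : ι → Vec n =>
      ∏ j, Complex.exp ((inner ℝ (x j) (a j • t) : ℝ) * Complex.I))
      (fun z : Vec n => Complex.exp ((inner ℝ z (b • t) : ℝ) * Complex.I)),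
    integral_fintype_prod_eq_prod (fun j (x : Vec n) =>
      Complex.exp ((inner ℝ x (a j • t) : ℝ) * Complex.I))]
  simp_rw [← charFun_apply, charFun_stdGaussian, ← Complex.exp_sum, ← Complex.exp_add, norm_smul,
    Complex.ofReal_mul, mul_pow]
  congr 1
  have h' : (∑ j, ‖a j‖ ^ 2 + ‖b‖ ^ 2 : ℝ) = ‖s‖ ^ 2 := by
    simpa [Real.norm_eq_abs, sq_abs] using h
  have h'' : (∑ j, (‖a j‖ : ℂ) ^ 2 + (‖b‖ : ℂ) ^ 2) = (‖s‖ : ℂ) ^ 2 := by exact_mod_cast h'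
  rw [← h'', ← Finset.sum_div, Finset.sum_neg_distrib, ← Finset.sum_mul]
  ring

end Gaussian

/-! ### Volume of the unit ball -/

section BallVolume

/-- A Stirling-type upper bound for the Gamma function. -/
theorem Gamma_add_one_le {x c : ℝ} (hx : 0 < x) (hc0 : 0 < c) (hc1 : c < 1) :
    Real.Gamma (x + 1) ≤ (x / (c * Real.exp 1)) ^ x / (1 - c) := by
  have h1c : 0 < 1 - c := by linarith
  have hexp : ∫ t in Set.Ioi (0 : ℝ), Real.exp (-(1 - c) * t) = 1 / (1 - c) := by
    rw [integral_exp_mul_Ioi (by linarith), mul_zero, Real.exp_zero, neg_div_neg_eq]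
  have hi : IntegrableOn (fun t : ℝ => Real.exp (-(1 - c) * t)) (Set.Ioi 0) :=
    integrableOn_exp_mul_Ioi (by linarith) 0
  rw [Real.Gamma_eq_integral (by linarith), div_eq_mul_one_div, ← hexp, ← integral_const_mul]
  refine setIntegral_mono_on (Real.GammaIntegral_convergent (by linarith)) (hi.const_mul _)
    measurableSet_Ioi fun t ht => ?_
  have ht : 0 < t := ht
  rw [add_sub_cancel_right, Real.rpow_def_of_pos ht, Real.rpow_def_of_pos (by positivity),
    ← Real.exp_add, ← Real.exp_add, Real.exp_le_exp, Real.log_div hx.ne' (by positivity),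
    Real.log_mul hc0.ne' (Real.exp_ne_zero _), Real.log_exp]
  -- This bounds the integrand `t ^ x e^{-t}` pointwise by `(x / (c e)) ^ x e^{-(1 - c) t}`, which
  -- integrates explicitly.
  have h := Real.log_le_sub_one_of_pos (show 0 < c * t / x by positivity)
  rw [Real.log_div (by positivity) hx.ne', Real.log_mul hc0.ne' ht.ne'] at h
  have h2 := mul_le_mul_of_nonneg_left h hx.le
  rw [mul_sub x (c * t / x), mul_div_cancel₀ _ hx.ne'] at h2
  linarith

theorem le_log_volume_closedBall {n : ℕ} (hn : n ≠ 0) {c : ℝ} (hc0 : 0 < c) (hc1 : c < 1) :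
    Real.log (1 - c) + n / 2 * (Real.log (2 * Real.pi * Real.exp 1) + Real.log c - Real.log n) ≤
      Real.log ((volume : Measure (Vec n)).real (Metric.closedBall 0 1)) := by
  have hn' : (0 : ℝ) < n := by positivity
  have : Nonempty (Fin n) := ⟨⟨0, Nat.pos_of_ne_zero hn⟩⟩
  have hG := Gamma_add_one_le (show (0 : ℝ) < n / 2 by positivity) hc0 hc1
  have hG0 : 0 < Real.Gamma ((n : ℝ) / 2 + 1) := Real.Gamma_pos_of_pos (by positivity)
  have h1c : 0 < 1 - c := by linarith
  have hlog := Real.log_le_log hG0 hG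
  have hpi := Real.pi_pos
  rw [Real.log_div (by positivity) h1c.ne', Real.log_rpow (by positivity),
    Real.log_div (by positivity) (by positivity), Real.log_div hn'.ne' two_ne_zero,
    Real.log_mul hc0.ne' (Real.exp_ne_zero _), Real.log_exp] at hlog
  rw [measureReal_def, EuclideanSpace.volume_closedBall, Fintype.card_fin, ENNReal.ofReal_one,
    one_pow, one_mul, ENNReal.toReal_ofReal (by positivity), Real.log_div (by positivity) hG0.ne',
    Real.log_pow, Real.log_sqrt hpi.le, Real.log_mul (by positivity) (Real.exp_ne_zero _),
    Real.log_mul two_ne_zero hpi.ne', Real.log_exp]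
  linarith

end BallVolume

/-- The uniform distribution over the Voronoi region is dominated by a Gaussian distribution. -/
theorem Lattice.cond_voronoi_le {n : ℕ} (L : Lattice n) {r s : ℝ} (hs : 0 < s)
    (h : L.voronoi ⊆ Metric.closedBall 0 r) :
    cond (volume : Measure (Vec n)) L.voronoi ≤
      ENNReal.ofReal ((Real.sqrt (2 * Real.pi) * s) ^ n * Real.exp (r ^ 2 / (2 * s ^ 2)) / L.vol) •
        (stdGaussian (Vec n)).map (fun z => s • z) := by
  refine Measure.le_iff.2 fun A hA => ?_
  have h1 := volume_le_gaussian (A := L.voronoi ∩ A) hs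
    (fun x hx => mem_closedBall_zero_iff.1 (h hx.1)) (L.measurableSet_voronoi.inter hA)
  rw [cond_apply L.measurableSet_voronoi, Measure.smul_apply, smul_eq_mul, div_eq_inv_mul,
    ENNReal.ofReal_mul (by have := L.vol_pos; positivity), ENNReal.ofReal_inv_of_pos L.vol_pos,
    Lattice.vol, measureReal_def, ENNReal.ofReal_toReal L.volume_voronoi_ne_top, mul_assoc]
  gcongr
  exact h1.trans (by gcongr; exact Set.inter_subset_right)

/-! ### Domination of product measures -/

section Pi

open scoped ENNReal

theorem pi_le_smul_pi {ι : Type*} [Fintype ι] {X : ι → Type*} [∀ i, MeasurableSpace (X i)]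
    {μ ν : ∀ i, Measure (X i)} [∀ i, IsFiniteMeasure (μ i)] [∀ i, IsFiniteMeasure (ν i)]
    {c : ι → ℝ≥0∞} (hc : ∀ i, c i ≠ ⊤) (h : ∀ i, μ i ≤ c i • ν i) :
    Measure.pi μ ≤ (∏ i, c i) • Measure.pi ν := by
  have : ∀ i, IsFiniteMeasure (c i • ν i) := fun i => Measure.smul_finite _ (hc i)
  have hpi : Measure.pi (fun i => c i • ν i) = (∏ i, c i) • Measure.pi ν :=
    Measure.pi_eq fun s _ => by
      simp [Measure.pi_pi, Finset.prod_mul_distrib]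
  rw [← hpi]
  refine Measure.le_iff.2 fun A hA => ?_
  -- An inequality on boxes need not pass to all measurable sets by a π-system argument. It does
  -- here because the product outer measure is the largest one below the given values on boxes.
  have hle : (Measure.pi μ).toOuterMeasure ≤
      OuterMeasure.pi fun i => (c i • ν i).toOuterMeasure := by
    rw [OuterMeasure.le_pi]
    intro s _
    change Measure.pi μ (Set.univ.pi s) ≤ _
    rw [Measure.pi_pi]
    exact Finset.prod_le_prod' fun i _ => h i (s i)
  refine (hle A).trans ?_
  rw [Measure.pi]
  exact le_toMeasure_apply _ _ A

end Pi

/-! ### Error events and the law of the effective noise -/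

namespace LatticeChain

variable {K n : ℕ} (c : LatticeChain K n)

theorem ncard_code (i : Fin K) :
    ((c.code i).ncard : ℝ) = (c.shaping i).vol / c.coding.vol :=
  (c.shaping i).ncard_mod_image c.coding (c.shaping_le_coding i)

theorem ncard_code_pos (i : Fin K) : 0 < (c.code i).ncard := by
  have : (0 : ℝ) < (c.code i).ncard := by
    rw [c.ncard_code]
    exact div_pos (c.shaping i).vol_pos c.coding.vol_pos
  exact_mod_cast this

theorem code_subset_coding (i : Fin K) : c.code i ⊆ c.coding.pts := by
  rintro _ ⟨x, hx, rfl⟩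
  exact sub_mem hx (c.shaping_le_coding i ((c.shaping i).Q_mem x))

instance isProbabilityMeasure_uniformOn_code (i : Fin K) :
    IsProbabilityMeasure (uniformOn (c.code i)) :=
  isProbabilityMeasure_uniformOn (Set.finite_of_ncard_pos (c.ncard_code_pos i))
    ((Set.ncard_pos (Set.finite_of_ncard_pos (c.ncard_code_pos i))).1 (c.ncard_code_pos i))

instance isProbabilityMeasure_law : IsProbabilityMeasure c.law := by
  unfold law
  infer_instance

theorem ae_mem_coding : ∀ᵐ ω ∂c.law, ∀ i, ω.1 i ∈ c.coding.pts := by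
  have h1 : ∀ i, ∀ᵐ w ∂(Measure.pi fun i => uniformOn (c.code i)), w i ∈ c.coding.pts := by
    intro i
    refine (Measure.quasiMeasurePreserving_eval (μ := fun i => uniformOn (c.code i)) i).ae ?_
    have hfin := Set.finite_of_ncard_pos (c.ncard_code_pos i)
    filter_upwards [ae_cond_mem (μ := Measure.count) hfin.measurableSet] with x hx
    exact c.code_subset_coding i hx
  exact Measure.quasiMeasurePreserving_fst.ae (ae_all_iff.2 h1)

theorem measurable_input (i : Fin K) : Measurable (c.input i) :=
  (c.shaping i).measurable_mod.comp (by fun_prop)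

theorem measurable_effNoise (a : ℝ) : Measurable (c.effNoise a) := by
  have := c.measurable_input
  unfold effNoise
  fun_prop

/-- The effective noise has an absolutely continuous distribution. -/
theorem ae_effNoise {a : ℝ} (ha : a ≠ 0) {p : Vec n → Prop}
    (hp : ∀ᵐ x ∂(volume : Measure (Vec n)), p x) : ∀ᵐ ω ∂c.law, p (c.effNoise a ω) := by
  obtain ⟨t, hpt, ht, ht0⟩ := exists_measurable_superset_of_null (ae_iff.1 hp)
  have hnull : c.law (c.effNoise a ⁻¹' t) = 0 := by
    unfold law
    have hm := c.measurable_effNoise a ht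
    rw [Measure.measure_prod_null hm]
    refine Eventually.of_forall fun w => ?_
    change ((Measure.pi fun i => cond volume (c.shaping i).voronoi).prod (stdGaussian (Vec n)))
      (Prod.mk w ⁻¹' (c.effNoise a ⁻¹' t)) = 0
    -- With codewords and dithers fixed, the effective noise is `a • Z` plus a constant, and `a ≠
    -- 0`.
    have hm' := measurable_prodMk_left (x := w) hm
    rw [Measure.measure_prod_null hm']
    refine Eventually.of_forall fun u => ?_
    refine stdGaussian_absolutelyContinuous n ?_
    have hset : Prod.mk u ⁻¹' (Prod.mk w ⁻¹' (c.effNoise a ⁻¹' t)) =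
        (fun z : Vec n => a • z) ⁻¹' ((fun z => -((1 - a) • ∑ j, (c.shaping j).mod (w j + u j)) + z)
          ⁻¹' t) := rfl
    rw [hset, Measure.addHaar_preimage_smul _ ha, measure_preimage_add, ht0, mul_zero]
  rw [ae_iff]
  exact measure_mono_null (fun ω hω => hpt hω) hnull

theorem effNoise_add (a : ℝ) (ω : Outcome K n) :
    a • c.output ω - ∑ j, ω.2.1 j =
      c.effNoise a ω + ∑ j, (ω.1 j - (c.shaping j).Q (ω.1 j + ω.2.1 j)) := by
  have h : ∑ j, (ω.1 j - (c.shaping j).Q (ω.1 j + ω.2.1 j)) =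
      ∑ j, c.input j ω - ∑ j, ω.2.1 j := by
    rw [← Finset.sum_sub_distrib]
    refine Finset.sum_congr rfl fun j _ => ?_
    simp only [input, Lattice.mod]
    abel
  rw [h, output, effNoise]
  module

section Error

variable [NeZero K]

/-- `Q_C` commutes with shifts by `Λ_C`, so before the final reduction the decoder's point differs
from the unreduced sum by `Q_C(Z̃)` up to `Λ₁`. -/
theorem modSum_eq_decoded_iff (a : ℝ) {ω : Outcome K n} (hω : ∀ i, ω.1 i ∈ c.coding.pts) :
    c.modSum ω = c.decoded a ω ↔ c.coding.Q (c.effNoise a ω) ∈ (c.shaping 0).pts := by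
  have hle := c.shaping_le_coding
  set t := ∑ j, (ω.1 j - (c.shaping j).Q (ω.1 j + ω.2.1 j)) with ht
  have htmem : t ∈ c.coding.pts :=
    sum_mem fun j _ => sub_mem (hω j) (hle j ((c.shaping j).Q_mem _))
  have hl := (c.shaping 0).Q_mem (c.effNoise a ω + t)
  have hQ : c.coding.Q (c.processed a ω) =
      c.coding.Q (c.effNoise a ω) + t - (c.shaping 0).Q (c.effNoise a ω + t) := by
    rw [processed, effNoise_add, ← ht, Lattice.mod, c.coding.Q_sub (hle 0 hl),
      c.coding.Q_add _ _ htmem]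
  rw [modSum, decoded, hQ, ← ht, eq_comm, Lattice.mod_eq_mod_iff,
    show c.coding.Q (c.effNoise a ω) + t - (c.shaping 0).Q (c.effNoise a ω + t) - t =
      c.coding.Q (c.effNoise a ω) - (c.shaping 0).Q (c.effNoise a ω + t) by abel]
  exact (c.shaping 0).pts.sub_mem_iff_left hl

/-- The two events differ only where `Q_C(Z̃)` lies in `Λ₁` without being `Q₁(Z̃)`. This requires a
tie, which is null for the absolutely continuous `Z̃`. -/
theorem errorProb_eq {a : ℝ} (ha : a ≠ 0) :
    c.errorProb a = c.law.real {ω | (c.shaping 0).mod (c.effNoise a ω) ∉ c.coding.voronoi} := by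
  unfold errorProb
  refine measureReal_congr ?_
  filter_upwards [c.ae_mem_coding,
    c.ae_effNoise ha ((c.shaping 0).ae_Q_eq_of_mem c.coding (c.shaping_le_coding 0))] with ω h1 h2
  refine propext ?_
  change ¬ c.modSum ω = c.decoded a ω ↔ ¬ (c.shaping 0).mod (c.effNoise a ω) ∈ c.coding.voronoi
  have hl := (c.shaping 0).Q_mem (c.effNoise a ω)
  rw [not_iff_not, c.modSum_eq_decoded_iff a h1, Lattice.mem_voronoi, Lattice.mod,
    c.coding.Q_sub (c.shaping_le_coding 0 hl), sub_eq_zero]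
  exact ⟨h2, fun h => h ▸ hl⟩

theorem errorProb_le (a : ℝ) :
    c.errorProb a ≤ c.law.real {ω | c.effNoise a ω ∉ c.coding.voronoi} := by
  refine ENNReal.toReal_mono (measure_ne_top _ _) (measure_mono_ae ?_)
  filter_upwards [c.ae_mem_coding] with ω h1 h2 h3
  refine h2 ((c.modSum_eq_decoded_iff a h1).2 ?_)
  rw [Lattice.mem_voronoi] at h3
  rw [h3]
  exact zero_mem _

end Error

/-- If the inputs are dominated by Gaussian distributions, the effective noise is dominated by a
Gaussian distribution as well. -/
theorem law_effNoise_le {a s : ℝ} {σ C : Fin K → ℝ} (hs : ∑ j, ((1 - a) * σ j) ^ 2 + a ^ 2 = s ^ 2)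
    (hC : ∀ j, cond (volume : Measure (Vec n)) (c.shaping j).voronoi ≤
      ENNReal.ofReal (C j) • (stdGaussian (Vec n)).map (fun z => σ j • z))
    {E : Set (Vec n)} (hE : MeasurableSet E) :
    c.law {ω | c.effNoise a ω ∈ E} ≤
      (∏ j, ENNReal.ofReal (C j)) * stdGaussian (Vec n) {z | s • z ∈ E} := by
  set γ := stdGaussian (Vec n) with hγ
  set U : Fin K → Measure (Vec n) := fun i => cond volume (c.shaping i).voronoi with hU
  let G : (Fin K → Vec n) × Vec n → Vec n := fun p => -((1 - a) • ∑ j, p.1 j) + a • p.2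
  have hG : Measurable G := by fun_prop
  -- Crypto lemma in each coordinate: given the codewords, the inputs are distributed as the
  -- dithers.
  have hslice : ∀ w : Fin K → Vec n,
      (Measure.pi U).prod γ (Prod.mk w ⁻¹' {ω | c.effNoise a ω ∈ E}) =
        (Measure.pi U).prod γ (G ⁻¹' E) := by
    intro w
    have hX : Measurable fun (u : Fin K → Vec n) j => (c.shaping j).mod (w j + u j) :=
      measurable_pi_lambda _ fun j => (c.shaping j).measurable_mod.comp (by fun_prop)
    have hmap : (Measure.pi U).map (fun u j => (c.shaping j).mod (w j + u j)) = Measure.pi U := by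
      have hm : ∀ j, AEMeasurable (fun u => (c.shaping j).mod (w j + u)) (U j) := fun j =>
        ((c.shaping j).measurable_mod.comp (measurable_const_add _)).aemeasurable
      have : ∀ j, IsProbabilityMeasure ((U j).map fun u => (c.shaping j).mod (w j + u)) := fun j =>
        Measure.isProbabilityMeasure_map (hm j)
      have := Measure.pi_map_pi hm
      rw [this]
      simp only [hU, Lattice.map_mod_add_cond_voronoi]
    have hprod : ((Measure.pi U).prod γ).map
        (Prod.map (fun u j => (c.shaping j).mod (w j + u j)) id) = (Measure.pi U).prod γ := by
      rw [← Measure.map_prod_map _ _ hX measurable_id, hmap, Measure.map_id]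
    conv_rhs => rw [← hprod, Measure.map_apply (hX.prodMap measurable_id) (hG hE)]
    rfl
  have hgauss : (Measure.pi U).prod γ (G ⁻¹' E) ≤
      (∏ j, ENNReal.ofReal (C j)) * γ {z | s • z ∈ E} := by
    have hσ : ∀ j, IsProbabilityMeasure (γ.map fun z => σ j • z) := fun j =>
      Measure.isProbabilityMeasure_map (by fun_prop)
    have h1 := pi_le_smul_pi (fun j => ENNReal.ofReal_ne_top) hC
    have h2 := Measure.prod_mono h1 (le_refl γ) (G ⁻¹' E)
    refine h2.trans_eq ?_
    rw [Measure.prod_smul_left, Measure.smul_apply, smul_eq_mul]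
    congr 1
    have hm : ∀ j : Fin K, AEMeasurable (fun z : Vec n => σ j • z) γ := fun j => by fun_prop
    have hm2 : Measurable fun (x : Fin K → Vec n) j => σ j • x j := by fun_prop
    have h3 := Measure.pi_map_pi hm
    rw [← h3]
    have h4 : ((Measure.pi fun _ : Fin K => γ).map fun x j => σ j • x j).prod γ =
        ((Measure.pi fun _ : Fin K => γ).prod γ).map (Prod.map (fun x j => σ j • x j) id) := by
      rw [← Measure.map_prod_map _ _ hm2 measurable_id, Measure.map_id]
    rw [h4, Measure.map_apply (hm2.prodMap measurable_id) (hG hE)]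
    have h5 := map_linearCombination_stdGaussian (n := n) (fun j => -((1 - a) * σ j)) a s
      (by simpa using hs)
    have h6 := congrArg (fun μ => μ E) h5
    simp only at h6
    rw [Measure.map_apply (by fun_prop) hE, Measure.map_apply (by fun_prop) hE] at h6
    refine Eq.trans ?_ h6
    congr 1
    ext p
    simp only [G, Set.mem_preimage, Prod.map_fst, Prod.map_snd, id, Finset.smul_sum, neg_smul,
      Finset.sum_neg_distrib, mul_smul]
  unfold law
  have hmE : MeasurableSet {ω | c.effNoise a ω ∈ E} := c.measurable_effNoise a hE
  rw [Measure.prod_apply hmE]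
  calc _ = ∫⁻ _, (Measure.pi U).prod γ (G ⁻¹' E) ∂(Measure.pi fun i => uniformOn (c.code i)) :=
        lintegral_congr fun w => hslice w
    _ = (Measure.pi U).prod γ (G ⁻¹' E) := by simp
    _ ≤ _ := hgauss

end LatticeChain

/-! ### Rogers-good lattices: asymptotics of radii and volume, Gaussian cost -/

section Shaping

variable {L : ∀ n, Lattice n} {P : ℝ}

theorem RogersGood.eventually_voronoi_subset (h : RogersGood L) :
    ∀ᶠ n in atTop, (L n).voronoi ⊆ Metric.closedBall 0 (L n).coveringRadius := by
  filter_upwards [h.eventually_ne one_ne_zero] with n hn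
  exact (L n).voronoi_subset_closedBall fun h0 => hn (by rw [h0, zero_div])

theorem RogersGood.tendsto_effectiveRadius_sq_div (h : RogersGood L) (hP : 0 < P)
    (hm : Tendsto (fun n => (L n).secondMoment) atTop (𝓝 P)) :
    Tendsto (fun n => (L n).effectiveRadius ^ 2 / n) atTop (𝓝 P) := by
  refine tendsto_order.2 ⟨fun a ha => ?_, fun a ha => ?_⟩
  · have h1 : Tendsto (fun n => (L n).secondMoment /
        ((L n).coveringRadius / (L n).effectiveRadius) ^ 2) atTop (𝓝 P) := by
      have := hm.div (h.pow 2) (by norm_num)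
      rwa [one_pow, div_one] at this
    filter_upwards [h1.eventually (lt_mem_nhds ha), h.eventually_voronoi_subset,
      h.eventually_ne one_ne_zero] with n h2 h3 h4
    refine h2.trans_le ?_
    rw [div_le_iff₀ (by positivity)]
    refine ((L n).secondMoment_le h3).trans_eq ?_
    have := (L n).effectiveRadius_pos
    field_simp
  -- With `b² = β < 1` the factor `b² (1 - b ^ n)` tends to `β`, and `β > P / a` keeps the resulting
  -- bound `P / β` below `a`.
  · obtain ⟨β, hβ1, hβ2⟩ := exists_between ((div_lt_one (hP.trans ha)).2 ha)
    have hβ0 : 0 < β := (div_pos hP (hP.trans ha)).trans hβ1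
    set b := Real.sqrt β with hb
    have hb0 : 0 < b := Real.sqrt_pos.2 hβ0
    have hb1 : b < 1 := by rw [hb, Real.sqrt_lt' one_pos]; simpa using hβ2
    have h1 : Tendsto (fun n : ℕ => b ^ 2 * (1 - b ^ n)) atTop (𝓝 (b ^ 2 * (1 - 0))) :=
      ((tendsto_pow_atTop_nhds_zero_of_lt_one hb0.le hb1).const_sub 1).const_mul _
    rw [sub_zero, mul_one, hb, Real.sq_sqrt hβ0.le] at h1
    have h2 := hm.div h1 hβ0.ne'
    have h3 : P / β < a := by
      rw [div_lt_iff₀ hβ0, mul_comm]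
      rwa [div_lt_iff₀ (hP.trans ha)] at hβ1
    filter_upwards [h2.eventually (gt_mem_nhds h3), h.eventually_voronoi_subset,
      eventually_ne_atTop 0] with n h4 h5 h6
    refine lt_of_le_of_lt ?_ h4
    have hpow : b ^ n < 1 := pow_lt_one₀ hb0.le hb1 h6
    have h7 := (L n).le_secondMoment h5 h6 hb0
    rw [hb, Real.sq_sqrt hβ0.le, ← hb] at h7
    rw [Pi.div_apply, le_div_iff₀ (mul_pos hβ0 (by linarith)), mul_comm]
    exact h7

theorem RogersGood.tendsto_coveringRadius_sq_div (h : RogersGood L) (hP : 0 < P)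
    (hm : Tendsto (fun n => (L n).secondMoment) atTop (𝓝 P)) :
    Tendsto (fun n => (L n).coveringRadius ^ 2 / n) atTop (𝓝 P) := by
  have h1 := (h.pow 2).mul (h.tendsto_effectiveRadius_sq_div hP hm)
  rw [one_pow, one_mul] at h1
  refine h1.congr fun n => ?_
  have := (L n).effectiveRadius_pos
  field_simp

/-- The volume of a Rogers-good lattice is asymptotically at least that of a ball with the same
second moment. -/
theorem RogersGood.eventually_le_log_vol (h : RogersGood L) (hP : 0 < P)
    (hm : Tendsto (fun n => (L n).secondMoment) atTop (𝓝 P)) {ε : ℝ} (hε : 0 < ε) :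
    ∀ᶠ n : ℕ in atTop,
      (n : ℝ) / 2 * (Real.log (2 * Real.pi * Real.exp 1 * P) - ε) ≤ Real.log (L n).vol := by
  have hpi := Real.pi_pos
  have he := Real.exp_pos 1
  -- The slack `ε` is split in three: the effective radius, `log c`, and the constant `log (1 - c)`,
  -- negligible against `n`.
  set c := Real.exp (-(ε / 3)) with hc
  have hc0 : 0 < c := Real.exp_pos _
  have hc1 : c < 1 := by
    rw [hc, ← Real.exp_zero, Real.exp_lt_exp]
    linarith
  have h1 := (h.tendsto_effectiveRadius_sq_div hP hm).log hP.ne'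
  have h2 : ∀ᶠ n : ℕ in atTop, -Real.log (1 - c) ≤ n * (ε / 6) :=
    (tendsto_natCast_atTop_atTop.atTop_mul_const (by positivity)).eventually_ge_atTop _
  filter_upwards [h1.eventually (lt_mem_nhds (show Real.log P - ε / 3 < Real.log P by linarith)),
    h2, eventually_ne_atTop 0] with n h3 h4 hn
  have hn' : (0 : ℝ) < n := by positivity
  have hr := (L n).effectiveRadius_pos
  have hV := le_log_volume_closedBall hn hc0 hc1
  rw [hc, Real.log_exp, ← hc] at hV
  rw [Real.log_div (by positivity) hn'.ne', Real.log_pow] at h3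
  rw [← (L n).effectiveRadius_pow hn,
    Real.log_mul (by positivity) Lattice.volume_closedBall_one_pos.ne', Real.log_pow,
    Real.log_mul (by positivity) hP.ne']
  have h5 := mul_le_mul_of_nonneg_left h3.le (show (0 : ℝ) ≤ n / 2 by positivity)
  push_cast at h5
  nlinarith

/-- The cost of replacing a uniform distribution over the Voronoi region of a Rogers-good lattice
by a Gaussian distribution of the same power is subexponential. -/
theorem RogersGood.eventually_gaussian_cost_le (h : RogersGood L) (hP : 0 < P)
    (hm : Tendsto (fun n => (L n).secondMoment) atTop (𝓝 P)) {ε : ℝ} (hε : 0 < ε) :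
    ∀ᶠ n : ℕ in atTop,
      (Real.sqrt (2 * Real.pi) * Real.sqrt P) ^ n *
        Real.exp ((L n).coveringRadius ^ 2 / (2 * Real.sqrt P ^ 2)) / (L n).vol ≤
      Real.exp (n * ε) := by
  have hpi := Real.pi_pos
  filter_upwards [h.eventually_le_log_vol hP hm hε,
    (h.tendsto_coveringRadius_sq_div hP hm).eventually
      (gt_mem_nhds (show P < P * (1 + ε) by nlinarith)), eventually_ne_atTop 0] with n h1 h2 hn
  have hn' : (0 : ℝ) < n := by positivity
  have hv := (L n).vol_pos
  have hs : 0 < Real.sqrt P := Real.sqrt_pos.2 hP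
  rw [← Real.log_le_iff_le_exp (by positivity), Real.log_div (by positivity) hv.ne',
    Real.log_mul (by positivity) (Real.exp_ne_zero _), Real.log_exp, Real.log_pow,
    Real.log_mul (by positivity) hs.ne', Real.log_sqrt (by positivity), Real.log_sqrt hP.le,
    Real.sq_sqrt hP.le]
  rw [Real.log_mul (by positivity) hP.ne', Real.log_mul (by positivity) (Real.exp_ne_zero _),
    Real.log_exp] at h1
  have h3 : (L n).coveringRadius ^ 2 / (2 * P) ≤ n / 2 * (1 + ε) := by
    rw [div_lt_iff₀ hn'] at h2
    rw [div_le_iff₀ (by positivity)]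
    nlinarith
  linarith

end Shaping

/-! ### The Poltyrev exponent and error bounds -/

section Exponent

theorem poltyrevExponent_pos {x : ℝ} (hx : 1 < x) : 0 < poltyrevExponent x := by
  unfold poltyrevExponent
  rw [if_neg (not_le.2 hx)]
  split_ifs with h1 h2
  · have := Real.log_lt_sub_one_of_pos (by linarith) hx.ne'
    linarith
  · have h3 : 1 < Real.exp 1 * x / 4 := by
      have := Real.exp_one_gt_d9
      nlinarith
    have := Real.log_pos h3
    linarith
  · linarith

/-- The Poltyrev exponent is left-continuous. -/
theorem exists_lt_poltyrevExponent {x ε : ℝ} (hx : 1 < x) (hε : 0 < ε) :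
    ∃ y, 1 < y ∧ y < x ∧ poltyrevExponent x - ε < poltyrevExponent y := by
  have key : ∀ (f : ℝ → ℝ) (m : ℝ), 1 ≤ m → m < x → ContinuousAt f x →
      (∀ y, m < y → y ≤ x → poltyrevExponent y = f y) →
      ∃ y, 1 < y ∧ y < x ∧ poltyrevExponent x - ε < poltyrevExponent y := by
    intro f m hm1 hmx hf hfm
    have h1 : ∀ᶠ y in 𝓝[<] x, f x - ε < f y :=
      (hf.mono_left nhdsWithin_le_nhds).eventually (lt_mem_nhds (by linarith))
    obtain ⟨y, hy1, hy2⟩ := (h1.and (Ioo_mem_nhdsLT hmx)).exists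
    refine ⟨y, hm1.trans_lt hy2.1, hy2.2, ?_⟩
    rw [hfm x hmx le_rfl, hfm y hy2.1 hy2.2.le]
    exact hy1
  have hx0 : x ≠ 0 := by positivity
  rcases le_or_gt x 2 with h2 | h2
  · refine key (fun y => (y - 1 - Real.log y) / 2) 1 le_rfl hx ?_ fun y hy1 hy2 => ?_
    · exact (((continuousAt_id.sub continuousAt_const).sub (Real.continuousAt_log hx0)).div_const _)
    · rw [poltyrevExponent, if_neg (not_le.2 hy1), if_pos (hy2.trans h2)]
  rcases le_or_gt x 4 with h4 | h4
  · refine key (fun y => Real.log (Real.exp 1 * y / 4) / 2) 2 one_le_two h2 ?_ fun y hy1 hy2 => ?_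
    · refine ContinuousAt.div_const (ContinuousAt.log (by fun_prop) ?_) _
      positivity
    · rw [poltyrevExponent, if_neg (by linarith), if_neg (not_le.2 hy1), if_pos (hy2.trans h4)]
  · refine key (fun y => y / 8) 4 (by norm_num) h4 (by fun_prop) fun y hy1 hy2 => ?_
    rw [poltyrevExponent, if_neg (by linarith), if_neg (by linarith), if_neg (not_le.2 hy1)]

theorem exists_exponent_error {p : ℕ → ℝ} {E : ℝ} (h0 : ∀ n, 0 ≤ p n) (h1 : p 0 ≤ 1)
    (h : ∀ ε : ℝ, 0 < ε → ∀ᶠ n : ℕ in atTop, p n ≤ Real.exp (-(n : ℝ) * (E - ε))) :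
    ∃ o : ℕ → ℝ, Tendsto o atTop (𝓝 0) ∧ ∀ n : ℕ, p n ≤ Real.exp (-(n : ℝ) * (E - o n)) := by
  -- The least nonnegative error term that works when `p n > 0` and `n > 0`. For `n = 0` the bound
  -- is `p 0 ≤ 1`.
  refine ⟨fun n => if p n = 0 then 0 else max 0 (E + Real.log (p n) / n), ?_, fun n => ?_⟩
  · refine tendsto_order.2 ⟨fun a ha => Eventually.of_forall fun n => ?_, fun a ha => ?_⟩
    · split_ifs
      · exact ha
      · exact ha.trans_le (le_max_left _ _)
    · filter_upwards [h (a / 2) (by linarith), eventually_ne_atTop 0] with n hn hn0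
      split_ifs with hp
      · exact ha
      · refine max_lt ha ?_
        have hn' : (0 : ℝ) < n := by positivity
        have hlog := (Real.log_le_iff_le_exp (lt_of_le_of_ne (h0 n) (Ne.symm hp))).2 hn
        have : Real.log (p n) / n ≤ -(E - a / 2) := by
          rw [div_le_iff₀ hn']
          linarith
        linarith
  · dsimp only
    split_ifs with hp
    · rw [hp]
      positivity
    · rcases eq_or_ne n 0 with rfl | hn
      · simpa using h1
      · have hn' : (0 : ℝ) < n := by positivity
        rw [← Real.log_le_iff_le_exp (lt_of_le_of_ne (h0 n) (Ne.symm hp))]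
        have h2 : E + Real.log (p n) / n ≤ max 0 (E + Real.log (p n) / n) := le_max_right _ _
        have h3 := mul_le_mul_of_nonneg_left h2 hn'.le
        rw [mul_add, mul_div_cancel₀ _ hn'.ne'] at h3
        linarith

theorem tendsto_zero_of_exponent {p : ℕ → ℝ} {E : ℝ} (hE : 0 < E) (h0 : ∀ n, 0 ≤ p n)
    (h : ∀ ε : ℝ, 0 < ε → ∀ᶠ n : ℕ in atTop, p n ≤ Real.exp (-(n : ℝ) * (E - ε))) :
    Tendsto p atTop (𝓝 0) := by
  refine squeeze_zero' (Eventually.of_forall h0) (h (E / 2) (by linarith)) ?_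
  refine Real.tendsto_exp_atBot.comp ?_
  have : Tendsto (fun n : ℕ => (n : ℝ) * (E - E / 2)) atTop atTop :=
    tendsto_natCast_atTop_atTop.atTop_mul_const (by linarith)
  exact (tendsto_neg_atTop_atBot.comp this).congr fun n => (neg_mul _ _).symm

/-- A Poltyrev-good lattice achieves the exponent `E_P(x)` whenever the volume-to-noise ratio is at
least `x`. -/
theorem PoltyrevGood.eventually_le {L : ∀ n, Lattice n} (h : PoltyrevGood L) {x ε : ℝ} (hx : 1 < x)
    (hε : 0 < ε) : ∀ᶠ n : ℕ in atTop, ∀ s : ℝ, 0 < s → x ≤ (L n).vnr (s ^ 2) →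
      (stdGaussian (Vec n)).real {z | s • z ∉ (L n).voronoi} ≤
        Real.exp (-(n : ℝ) * (poltyrevExponent x - ε)) := by
  have hpi := Real.pi_pos
  filter_upwards [h x hx ε hε] with n hn s hs hxs
  have hx0 : 0 < x := by linarith
  have hv : 0 < (L n).vol ^ (2 / (n : ℝ)) := Real.rpow_pos_of_pos (L n).vol_pos _
  -- The noise variance giving ratio exactly `x`. It is at least `s ^ 2`, and by star-shapedness
  -- larger noise leaves the region more often.
  set w := (L n).vol ^ (2 / (n : ℝ)) / (2 * Real.pi * Real.exp 1 * x) with hw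
  have hw0 : 0 < w := by positivity
  have hsw : s ^ 2 ≤ w := by
    rw [Lattice.vnr, le_div_iff₀ (by positivity)] at hxs
    rw [hw, le_div_iff₀ (by positivity)]
    linarith
  have hvnr : (L n).vnr (Real.sqrt w ^ 2) = x := by
    rw [Real.sq_sqrt hw0.le, Lattice.vnr, hw]
    field_simp
  have hsub : {z | s • z ∉ (L n).voronoi} ⊆ {z | Real.sqrt w • z ∉ (L n).voronoi} :=
    fun z hz hz' => hz ((L n).smul_mem_voronoi hs (Real.le_sqrt_of_sq_le hsw) hz')
  exact (measureReal_mono hsub).trans (hn (Real.sqrt w) (Real.sqrt_pos.2 hw0) hvnr)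

end Exponent

/-! ### Rates, volume-to-noise ratio and the exponential bound -/

namespace LatticeChain

theorem rate_eq {K n : ℕ} (c : LatticeChain K n) (i : Fin K) :
    c.rate i = 1 / (n : ℝ) * ((Real.log (c.shaping i).vol - Real.log c.coding.vol) / Real.log 2) := by
  rw [rate, c.ncard_code, Real.logb, Real.log_div (c.shaping i).vol_pos.ne' c.coding.vol_pos.ne']

theorem rate_nonneg {K n : ℕ} (c : LatticeChain K n) (i : Fin K) : 0 ≤ c.rate i := by
  refine mul_nonneg (by positivity) (Real.logb_nonneg one_lt_two ?_)
  exact_mod_cast c.ncard_code_pos i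

end LatticeChain

namespace GoodChain

variable {K : ℕ} {P : Fin K → ℝ} {c : ∀ n, LatticeChain K n}

theorem tendsto_secondMoment (hc : GoodChain P c) (i : Fin K) :
    Tendsto (fun n => ((c n).shaping i).secondMoment) atTop (𝓝 (P i)) := by
  refine tendsto_order.2 ⟨fun a ha => ?_, fun a ha => ?_⟩
  · filter_upwards [hc.power i ((P i - a) / 2) (by linarith)] with n hn
    linarith [hn.1]
  · filter_upwards [hc.power i 1 one_pos] with n hn
    exact hn.2.trans_lt ha

/-- The coding rates of two nodes differ asymptotically by half the logarithm of the ratio of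
their powers. -/
theorem tendsto_rate_sub (hc : GoodChain P c) (hP : ∀ i, 0 < P i) (i j : Fin K) :
    Tendsto (fun n => (c n).rate i - (c n).rate j) atTop
      (𝓝 (1 / 2 * Real.logb 2 (P i) - 1 / 2 * Real.logb 2 (P j))) := by
  have h : ∀ i, Tendsto (fun n => 1 / 2 * Real.logb 2 (((c n).shaping i).effectiveRadius ^ 2 / n))
      atTop (𝓝 (1 / 2 * Real.logb 2 (P i))) := fun i =>
    ((((hc.shaping_rogers i).tendsto_effectiveRadius_sq_div (hP i)
      (hc.tendsto_secondMoment i)).log (hP i).ne').div_const _).const_mul _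
  refine ((h i).sub (h j)).congr' ?_
  filter_upwards [eventually_ne_atTop 0] with n hn
  have hn' : (0 : ℝ) < n := by positivity
  have hl := Real.log_pos one_lt_two
  have hr : ∀ i, 0 < ((c n).shaping i).effectiveRadius := fun i =>
    ((c n).shaping i).effectiveRadius_pos
  -- The unit-ball volume and the volume of `Λ_C` cancel in the difference of rates.
  have hvol : ∀ i, Real.log ((c n).shaping i).vol = n * Real.log ((c n).shaping i).effectiveRadius +
      Real.log ((volume : Measure (Vec n)).real (Metric.closedBall 0 1)) := fun i => by
    rw [← ((c n).shaping i).effectiveRadius_pow hn, Real.log_mul (pow_pos (hr i) n).ne'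
      Lattice.volume_closedBall_one_pos.ne', Real.log_pow]
  rw [(c n).rate_eq, (c n).rate_eq, hvol i, hvol j, Real.logb, Real.logb,
    Real.log_div (pow_pos (hr i) 2).ne' hn'.ne', Real.log_div (pow_pos (hr j) 2).ne' hn'.ne',
    Real.log_pow, Real.log_pow]
  field_simp
  push_cast
  ring

variable [NeZero K]

theorem sum_pos (hP : ∀ i, 0 < P i) : 0 < ∑ j, P j :=
  Finset.sum_pos (fun i _ => hP i) ⟨0, Finset.mem_univ _⟩

theorem mmse_pos (hP : ∀ i, 0 < P i) : 0 < mmse P := by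
  have := sum_pos hP
  unfold mmse
  positivity

/-- With MMSE scaling the effective noise variance `(1 - α)² ∑ P_j + α²` collapses to `α`. -/
theorem sum_mmse (hP : ∀ i, 0 < P i) :
    ∑ j, ((1 - mmse P) * Real.sqrt (P j)) ^ 2 + mmse P ^ 2 = Real.sqrt (mmse P) ^ 2 := by
  have hS := sum_pos hP
  rw [Real.sq_sqrt (mmse_pos hP).le]
  have : ∀ j, ((1 - mmse P) * Real.sqrt (P j)) ^ 2 = (1 - mmse P) ^ 2 * P j := fun j => by
    rw [mul_pow, Real.sq_sqrt (hP j).le]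
  simp_rw [this]
  rw [← Finset.mul_sum]
  unfold mmse
  field_simp
  ring

/-- The volume-to-noise ratio of the coding lattice for the effective noise. -/
theorem eventually_lt_vnr (hc : GoodChain P c) (hP : ∀ i, 0 < P i) {R : ℝ}
    (hrate : Tendsto (fun n => (c n).rate 0) atTop (𝓝 R)) {x : ℝ} (hx0 : 0 < x)
    (hx : Real.log x < Real.log (P 0 / ∑ j, P j + P 0) - 2 * R * Real.log 2) :
    ∀ᶠ n in atTop, x ≤ (c n).coding.vnr (Real.sqrt (mmse P) ^ 2) := by
  have hpi := Real.pi_pos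
  have hS := sum_pos hP
  have ha := mmse_pos hP
  have hl := Real.log_pos one_lt_two
  set δ := Real.log (P 0 / ∑ j, P j + P 0) - 2 * R * Real.log 2 - Real.log x with hδ
  have hδ0 : 0 < δ := by linarith
  have hlog : Real.log (P 0 / ∑ j, P j + P 0) = Real.log (P 0) - Real.log (mmse P) := by
    rw [← Real.log_div (hP 0).ne' ha.ne']
    congr 1
    unfold mmse
    field_simp
    rw [add_comm]
  filter_upwards [(hc.shaping_rogers 0).eventually_le_log_vol (hP 0) (hc.tendsto_secondMoment 0)
    (half_pos hδ0), (hrate.mul_const (2 * Real.log 2)).eventually (gt_mem_nhds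
      (show R * (2 * Real.log 2) < R * (2 * Real.log 2) + δ / 2 by linarith)),
    eventually_ne_atTop 0] with n h1 h2 hn
  have hn' : (0 : ℝ) < n := by positivity
  have hv := (c n).coding.vol_pos
  rw [Real.sq_sqrt ha.le, Lattice.vnr, ← Real.log_le_log_iff hx0 (by positivity),
    Real.log_div (by positivity) (by positivity), Real.log_rpow hv,
    Real.log_mul (by positivity) ha.ne']
  rw [Real.log_mul (by positivity) (hP 0).ne'] at h1
  rw [(c n).rate_eq] at h2
  have h3 : 1 / (n : ℝ) * ((Real.log ((c n).shaping 0).vol - Real.log (c n).coding.vol) /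
      Real.log 2) * (2 * Real.log 2) =
      2 / n * Real.log ((c n).shaping 0).vol - 2 / n * Real.log (c n).coding.vol := by
    field_simp
  rw [h3] at h2
  have h4 := mul_le_mul_of_nonneg_left h1 (show (0 : ℝ) ≤ 2 / n by positivity)
  rw [← mul_assoc, div_mul_div_comm, mul_comm (2 : ℝ) n, div_self (by positivity), one_mul] at h4
  linarith

theorem eventually_errorProb_le (hc : GoodChain P c) (hP : ∀ i, 0 < P i) {R : ℝ}
    (hrate : Tendsto (fun n => (c n).rate 0) atTop (𝓝 R)) {x : ℝ} (hx1 : 1 < x)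
    (hx : Real.log x = Real.log (P 0 / ∑ j, P j + P 0) - 2 * R * Real.log 2) {ε : ℝ} (hε : 0 < ε) :
    ∀ᶠ n : ℕ in atTop,
      (c n).errorProb (mmse P) ≤ Real.exp (-(n : ℝ) * (poltyrevExponent x - ε)) := by
  have ha := mmse_pos hP
  -- One share for each of the `K` Gaussian replacements, one for left-continuity of the exponent,
  -- one for Poltyrev-goodness.
  set η := ε / (K + 2) with hη
  have hη0 : 0 < η := by positivity
  have hηε : ε = K * η + 2 * η := by rw [hη]; field_simp
  obtain ⟨y, hy1, hyx, hy⟩ := exists_lt_poltyrevExponent hx1 hη0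
  have hylog : Real.log y < Real.log x := Real.log_lt_log (by linarith) hyx
  filter_upwards [hc.eventually_lt_vnr hP hrate (by linarith) (hylog.trans_eq hx),
    hc.coding_poltyrev.eventually_le hy1 hη0,
    eventually_all.2 fun j => (hc.shaping_rogers j).eventually_gaussian_cost_le (hP j)
      (hc.tendsto_secondMoment j) hη0,
    eventually_all.2 fun j => (hc.shaping_rogers j).eventually_voronoi_subset] with n h1 h2 h3 h4
  have h5 := h2 _ (Real.sqrt_pos.2 ha) h1
  have hdom := (c n).law_effNoise_le (sum_mmse hP)
    (fun j => ((c n).shaping j).cond_voronoi_le (Real.sqrt_pos.2 (hP j)) (h4 j))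
    (c n).coding.measurableSet_voronoi.compl
  have hreal := ENNReal.toReal_mono (by
    refine ENNReal.mul_ne_top (ENNReal.prod_ne_top fun _ _ => ENNReal.ofReal_ne_top)
      (measure_ne_top _ _)) hdom
  rw [ENNReal.toReal_mul, ENNReal.toReal_prod] at hreal
  refine ((c n).errorProb_le _).trans (hreal.trans ?_)
  calc _ ≤ (∏ _j : Fin K, Real.exp (n * η)) * Real.exp (-(n : ℝ) * (poltyrevExponent y - η)) := by
        refine mul_le_mul (Finset.prod_le_prod (fun _ _ => ENNReal.toReal_nonneg) fun j _ => ?_) h5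
          ENNReal.toReal_nonneg (by positivity)
        rw [ENNReal.toReal_ofReal (by have := ((c n).shaping j).vol_pos; positivity)]
        exact h3 j
    _ = Real.exp (-(n : ℝ) * (poltyrevExponent y - η - K * η)) := by
        rw [Finset.prod_const, Finset.card_univ, Fintype.card_fin, ← Real.exp_nat_mul,
          ← Real.exp_add]
        congr 1
        ring
    _ ≤ _ := by
        rw [Real.exp_le_exp, neg_mul, neg_mul, neg_le_neg_iff]
        refine mul_le_mul_of_nonneg_left ?_ (by positivity)
        linarith

end GoodChain

end

end NestedLattice

/-! ### The main theorem -/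

theorem theorem3 {K : ℕ} [NeZero K] (P : Fin K → ℝ) (hPpos : ∀ i, 0 < P i) (hP : Antitone P)
    (Rbar : ℝ) (hR : Rbar < NestedLattice.targetRate P 0)
    (c : ∀ n, NestedLattice.LatticeChain K n) (hc : NestedLattice.GoodChain P c)
    (hrate : Tendsto (fun n => (c n).rate 0) atTop (𝓝 Rbar)) :
    -- the two expressions of the error probability agree
    (∀ n, (c n).errorProb (NestedLattice.mmse P) =
      (c n).law.real {ω | ((c n).shaping 0).mod ((c n).effNoise (NestedLattice.mmse P) ω) ∉
        (c n).coding.voronoi}) ∧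
    -- the error exponent
    (∃ o : ℕ → ℝ, Tendsto o atTop (𝓝 0) ∧ ∀ n : ℕ,
      (c n).errorProb (NestedLattice.mmse P) ≤
        Real.exp (-(n : ℝ) * (NestedLattice.poltyrevExponent
          ((2 : ℝ) ^ (2 * (NestedLattice.targetRate P 0 - Rbar))) - o n))) ∧
    -- reliable computation of the modular sum, with all coding rates as close to the target
    -- rates as the first one is
    Tendsto (fun n => (c n).errorProb (NestedLattice.mmse P)) atTop (𝓝 0) ∧
    (∀ i, Tendsto (fun n => (c n).rate i) atTop
      (𝓝 (NestedLattice.targetRate P i - (NestedLattice.targetRate P 0 - Rbar)))) := by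
  open NestedLattice in
  have hl := Real.log_pos one_lt_two
  have hS := GoodChain.sum_pos hPpos
  set B := 1 / ∑ j, P j + 1 with hB
  have hB0 : 0 < B := by positivity
  have hfac : ∀ i, P i / ∑ j, P j + P i = P i * B := fun i => by rw [hB]; ring
  have hlogb : ∀ i, 1 / 2 * Real.logb 2 (P i / ∑ j, P j + P i) =
      1 / 2 * Real.logb 2 (P i) + 1 / 2 * Real.logb 2 B := fun i => by
    rw [hfac, Real.logb_mul (hPpos i).ne' hB0.ne', mul_add]
  have hRbar : 0 ≤ Rbar := ge_of_tendsto' hrate fun n => (c n).rate_nonneg 0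
  have htarget : targetRate P 0 = 1 / 2 * Real.logb 2 (P 0 / ∑ j, P j + P 0) := by
    rw [targetRate, max_eq_left]
    -- An active positive part would give target `0`, hence `Rbar < 0`, against nonnegativity of the
    -- rates.
    by_contra hcon
    rw [targetRate, max_eq_right (not_le.1 hcon).le] at hR
    linarith
  have hrates : ∀ i, Tendsto (fun n => (c n).rate i) atTop
      (𝓝 (1 / 2 * Real.logb 2 (P i) - 1 / 2 * Real.logb 2 (P 0) + Rbar)) := fun i =>
    ((hc.tendsto_rate_sub hPpos i 0).add hrate).congr fun n => sub_add_cancel _ _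
  set x := (2 : ℝ) ^ (2 * (targetRate P 0 - Rbar)) with hx
  have hx1 : 1 < x := Real.one_lt_rpow one_lt_two (by linarith)
  have hxlog : Real.log x = Real.log (P 0 / ∑ j, P j + P 0) - 2 * Rbar * Real.log 2 := by
    rw [hx, Real.log_rpow two_pos, htarget, Real.logb]
    field_simp
  have hbound := fun ε (hε : (0 : ℝ) < ε) => hc.eventually_errorProb_le hPpos hrate hx1 hxlog hε
  refine ⟨fun n => (c n).errorProb_eq (GoodChain.mmse_pos hPpos).ne',
    exists_exponent_error (fun n => measureReal_nonneg) measureReal_le_one hbound,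
    tendsto_zero_of_exponent (poltyrevExponent_pos hx1) (fun n => measureReal_nonneg) hbound,
    fun i => ?_⟩
  -- The limiting rate is the unclipped target of node `i` minus a positive gap; being nonnegative,
  -- it shows that this target is not clipped.
  have hlim : 0 ≤ 1 / 2 * Real.logb 2 (P i) - 1 / 2 * Real.logb 2 (P 0) + Rbar :=
    ge_of_tendsto' (hrates i) fun n => (c n).rate_nonneg i
  have htargeti : targetRate P i = 1 / 2 * Real.logb 2 (P i / ∑ j, P j + P i) := by
    rw [targetRate, max_eq_left]
    rw [hlogb] at htarget ⊢
    linarith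
  convert hrates i using 2
  rw [htarget, htargeti, hlogb, hlogb]
  ring
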